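/- Let $m\ge 1$, $N\ge 0$, $\mathbb R_+=[0,\infty)$, and let $B=(b_{ij})$ be a real $m\times m$ matrix with $b_{ij}\le 0$ for $j\neq i$ and $\sum_{j}b_{ij}=0$ for every $i$. Let $\Omega$ be the set of càdlàg (right-continuous with left-hand limits) paths $\omega:\mathbb R_+\to\{1,\dots,m\}$, equipped with the smallest $\sigma$-algebra $\mathcal F$ making all evaluations $\omega\mapsto\omega(t)$, $t\ge 0$, measurable (this is the Borel $\sigma$-algebra of the Skorohod topology). Let $\mathbb P$ be a probability measure on $(\Omega,\mathcal F)$ under which $(\omega(t))_{t\ge0}$ is a Markov chain with generator $-B$: for all $k\ge 2$, all times $0\le t_1<\dots<t_k$ and all states $i_1,\dots,i_k$, $$\mathbb P\big(\omega(t_k)=i_k\,\big|\,\omega(t_1)=i_1,\dots,\omega(t_{k-1})=i_{k-1}\big)=\big(e^{-B(t_k-t_{k-1})}\big)_{i_{k-1}i_k}$$ whenever the conditioning event has positive probability. For $i\in\{1,\dots,m\}$ let $\mathbb P_i$ be $\mathbb P$ conditioned to $\{\omega:\omega(0)=i\}$ (with $\mathbb P_i=0$ if this event is $\mathbb P$-null),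 and let $\mathbb E_i$ denote integration with respect to $\mathbb P_i$. An *admissible curve* is a map $\gamma:\Omega\to C(\mathbb R_+;\mathbb R^N)$, measurable from $\mathcal F$ to the Borel $\sigma$-algebra of the topology of local uniform convergence, such that, writing $\gamma(t,\omega)=\gamma(\omega)(t)$: (i) for every bounded interval $I\subset\mathbb R_+$ and every $\varepsilon>0$ there is $\delta>0$ such that $\sum_j|\gamma(b_j,\omega)-\gamma(a_j,\omega)|<\varepsilon$ for every $\omega\in\Omega$ and every finite family $\{(a_j,b_j)\}$ of pairwise disjoint intervals contained in $I$ with $\sum_j(b_j-a_j)<\delta$; (ii) for every $t\ge0$, if $\omega_1=\omega_2$ on $[0,t]$, then $\gamma(\cdot,\omega_1)=\gamma(\cdot,\omega_2)$ on $[0,t]$. **Theorem.** Let $\mathbf u=(u_1,\dots,u_m):\mathbb R_+\times\mathbb R^N\to\mathbb R^m$ be locally Lipschitz, let $\gamma$ be an admissible curve and let $i\in\{1,\dots,m\}$. Then $\omega\mapsto u_{\omega(t)}(t,\gamma(t,\omega))$ is $\mathbb P_i$-integrable for every $t\ge 0$, and for a.e. $s\in\mathbb R_+$ the following hold: for $\mathbb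 P_i$-a.e. $\omega$ the function $t\mapsto u_{\omega(s)}(t,\gamma(t,\omega))$ is differentiable at $s$; the random variable inside the expectation on the right-hand side below is $\mathbb P_i$-integrable; the function $t\mapsto\mathbb E_i\big[u_{\omega(t)}(t,\gamma(t,\omega))\big]$ is differentiable at $s$; and $$\frac{d}{dt}\,\mathbb E_i\big[u_{\omega(t)}(t,\gamma(t,\omega))\big]\Big|_{t=s}=\mathbb E_i\Big[-(B\mathbf u)_{\omega(s)}(s,\gamma(s,\omega))+\frac{d}{dt}\,u_{\omega(s)}(t,\gamma(t,\omega))\Big|_{t=s}\Big].$$ -/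

import Mathlib

open MeasureTheory ProbabilityTheory Filter Topology Matrix
open scoped NNReal ENNReal

namespace RandomSwitching

/-- Sample space `Ω`: the càdlàg paths `ω : ℝ₊ → {1, …, m}` (the state space is discrete). -/
structure CadlagPath (m : ℕ) where
  toFun : ℝ≥0 → Fin m
  right_continuous : ∀ t, ContinuousWithinAt toFun (Set.Ici t) t
  left_limit : ∀ t, ∃ l, Tendsto toFun (𝓝[<] t) (𝓝 l)

instance (m : ℕ) : CoeFun (CadlagPath m) (fun _ => ℝ≥0 → Fin m) := ⟨CadlagPath.toFun⟩

/-- The `σ`-algebra `ℱ` on `Ω`: the smallest one making all evaluations `π_t : ω ↦ ω(t)`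
measurable; it is generated by the cylinders, and is the Borel `σ`-algebra of the Skorohod
topology. -/
instance (m : ℕ) : MeasurableSpace (CadlagPath m) :=
  ⨆ t : ℝ≥0, MeasurableSpace.comap (fun ω : CadlagPath m => ω t) ⊤

/-- The cylinder `{ω | ω(t₁) = i₁, …, ω(t_k) = i_k}`. -/
def pathCylinder {m k : ℕ} (t : Fin k → ℝ≥0) (i : Fin k → Fin m) : Set (CadlagPath m) :=
  {ω | ∀ j, ω (t j) = i j}

/-- The conditions on the coupling matrix: nonpositive off-diagonal entries, zero row sums. -/
structure IsCouplingMatrix {m : ℕ} (B : Matrix (Fin m) (Fin m) ℝ) : Prop where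
  off_diag : ∀ i j, j ≠ i → B i j ≤ 0
  row_sum : ∀ i, ∑ j, B i j = 0

/-- Under `P` the evaluation process is a Markov chain with generator `-B`: for all times
`t₀ < … < t_k < t_{k+1}` and all states,
`P(ω(t_{k+1}) = i_{k+1} | ω(t₀) = i₀, …, ω(t_k) = i_k) = (exp(-(t_{k+1} - t_k) B))_{i_k i_{k+1}}`
whenever the conditioning event has positive probability. -/
def IsMarkovChain {m : ℕ} (B : Matrix (Fin m) (Fin m) ℝ) (P : Measure (CadlagPath m)) : Prop :=
  ∀ (k : ℕ) (t : Fin (k + 2) → ℝ≥0) (i : Fin (k + 2) → Fin m), StrictMono t →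
    P (pathCylinder (fun j : Fin (k + 1) => t j.castSucc) (fun j => i j.castSucc)) ≠ 0 →
    (P[|pathCylinder (fun j : Fin (k + 1) => t j.castSucc) (fun j => i j.castSucc)]).real
        {ω | ω (t (Fin.last (k + 1))) = i (Fin.last (k + 1))} =
      NormedSpace.exp
        (-(((t (Fin.last (k + 1)) : ℝ) - (t (Fin.last k).castSucc : ℝ)) • B))
        (i (Fin.last k).castSucc) (i (Fin.last (k + 1)))

/-- `P_i`: the measure `P` conditioned to `Ω_i = {ω | ω(0) = i}`
(the zero measure when `P(Ω_i) = 0`). -/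
noncomputable def condStart {m : ℕ} (P : Measure (CadlagPath m)) (i : Fin m) :
    Measure (CadlagPath m) :=
  P[|{ω : CadlagPath m | ω 0 = i}]

/-- Admissible curves: random variables `γ : Ω → C(ℝ₊; ℝᴺ)` (topology of local uniform
convergence, Borel `σ`-algebra) which are locally absolutely continuous in time, uniformly in
`ω`, and nonanticipating. -/
structure IsAdmissibleCurve {m N : ℕ}
    (γ : CadlagPath m → C(ℝ≥0, EuclideanSpace ℝ (Fin N))) : Prop where
  measurable : Measurable[_, borel C(ℝ≥0, EuclideanSpace ℝ (Fin N))] γ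
  /-- It suffices to consider the bounded intervals `[0, T]`. -/
  equi_absolutely_continuous : ∀ T : ℝ≥0, ∀ ε : ℝ, 0 < ε → ∃ δ : ℝ, 0 < δ ∧
    ∀ (n : ℕ) (a b : Fin n → ℝ≥0), (∀ j, a j ≤ b j) → (∀ j, b j ≤ T) →
      Pairwise (fun j k => Disjoint (Set.Ioo (a j) (b j)) (Set.Ioo (a k) (b k))) →
      ∑ j, ((b j : ℝ) - (a j : ℝ)) < δ →
      ∀ ω, ∑ j, ‖γ ω (b j) - γ ω (a j)‖ < ε
  nonanticipating : ∀ (t : ℝ≥0) (ω₁ ω₂ : CadlagPath m),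
    (∀ s, s ≤ t → ω₁ s = ω₂ s) → ∀ s, s ≤ t → γ ω₁ s = γ ω₂ s

end RandomSwitching

/-!
Write `μ` for `P` conditioned to start at `i`, `F_j(t, ω) = u_j(t, γ(t, ω))`, and `q(h) = exp(-hB)`.
For times `s ≠ t` the increment of the expectation is

`E[F_{ω(t)}(t)] - E[F_{ω(s)}(s)]
  = E[((q(t - s) - 1) F(min s t))_{ω(s)}] + E[(F(t) - F(s))_{ω(max s t)}]`,

whichever of `s`, `t` is the larger (`IsAdmissibleCurve.integral_increment`). This is the Markov
property, for integrands that depend on the path up to the earlier time only. Such a dependence is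
expressed by invariance under stopping the path at that time: the curve is nonanticipating, so
`γ(s, ω)` does not change when `ω` is stopped at `s`, and the Markov property for functions of the
stopped path follows from the finite-dimensional one, cylinders being a π-system
(`IsMarkovChain.integral_eval_comp`).

Divided by `t - s`, the first term tends to `E[-(B F(s))_{ω(s)}]` at every `s > 0`, because
`q'(0) = -B` and `F` is continuous in time and bounded on `[0, s]`. In the second term,
`ω(max s t) = ω(s)` for `t` close to `s`, by right-continuity of the paths, so it is enough that
the difference quotients of `F_j` at `s` converge in `L¹(μ)`. They do so for almost every `s`,
although they need not be dominated
(`UniformlyAbsolutelyContinuous.ae_tendsto_integral_abs_slope_sub_deriv`): by Scheffé's lemma,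
almost sure convergence has to be supplemented only by convergence of the `L¹` norms; these are at
most the averages over `[s, t]` of `e(r) = E|∂_t F_j(r)|`, which tend to `e(s)` by the Lebesgue
differentiation theorem, once `e` is known to be locally integrable. The latter holds because
`t ↦ F_j(t)` is absolutely continuous as a map into `L¹(μ)`, hence of bounded variation.
-/

namespace RandomSwitching

/-! ### Difference quotients of absolutely continuous families -/

section L1Derivative

open AbsolutelyContinuousOnInterval Set

variable {Ω : Type*} {F : ℝ → Ω → ℝ} {T : ℝ}

/-- The real functions `t ↦ F t ω` on `[a, b]` are absolutely continuous, with a modulus that does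
not depend on `ω`. -/
def UniformlyAbsolutelyContinuous (F : ℝ → Ω → ℝ) (a b : ℝ) : Prop :=
  ∀ ε > (0 : ℝ), ∃ δ > (0 : ℝ), ∀ E ∈ disjWithin a b,
    ∑ i ∈ Finset.range E.1, dist (E.2 i).1 (E.2 i).2 < δ →
      ∀ ω, ∑ i ∈ Finset.range E.1, dist (F (E.2 i).1 ω) (F (E.2 i).2 ω) < ε

lemma UniformlyAbsolutelyContinuous.apply {a b : ℝ} (hF : UniformlyAbsolutelyContinuous F a b)
    (ω : Ω) : AbsolutelyContinuousOnInterval (fun t => F t ω) a b := by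
  rw [absolutelyContinuousOnInterval_iff]
  intro ε hε
  obtain ⟨δ, hδ, h⟩ := hF ε hε
  exact ⟨δ, hδ, fun E hE hs => h E hE hs ω⟩

variable [MeasurableSpace Ω] {μ : Measure Ω}

/-- Scheffé's lemma: almost everywhere convergence, together with an upper bound on the limit of
the `L¹` norms, gives convergence in `L¹`. -/
lemma tendsto_integral_abs_sub_of_ae_tendsto {ι : Type*} {l : Filter ι} [l.IsCountablyGenerated]
    {G : ι → Ω → ℝ} {g : Ω → ℝ} {c : ι → ℝ} (hG : ∀ᶠ i in l, Integrable (G i) μ)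
    (hg : Integrable g μ) (hlim : ∀ᵐ ω ∂μ, Tendsto (fun i => G i ω) l (𝓝 (g ω)))
    (hc : Tendsto c l (𝓝 (∫ ω, |g ω| ∂μ))) (hle : ∀ᶠ i in l, ∫ ω, |G i ω| ∂μ ≤ c i) :
    Tendsto (fun i => ∫ ω, |G i ω - g ω| ∂μ) l (𝓝 0) := by
  have key : Tendsto (fun i => ∫ ω, (|G i ω| + |g ω| - |G i ω - g ω|) ∂μ) l
      (𝓝 (∫ ω, (|g ω| + |g ω| - |g ω - g ω|) ∂μ)) := by
    -- The integrand lies between `0` and `2 |g|`, whatever the size of `G i`.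
    refine tendsto_integral_filter_of_dominated_convergence (fun ω => 2 * |g ω|) ?_ ?_
      (hg.abs.const_mul 2) ?_
    · filter_upwards [hG] with i hi
      exact ((hi.abs.add hg.abs).sub (hi.sub hg).abs).aestronglyMeasurable
    · refine Eventually.of_forall fun i => Eventually.of_forall fun ω => ?_
      rw [Real.norm_eq_abs, abs_le]
      have h1 := abs_sub_abs_le_abs_sub (G i ω) (g ω)
      have h2 := abs_sub (G i ω) (g ω)
      have h3 := abs_nonneg (g ω)
      constructor <;> linarith
    · filter_upwards [hlim] with ω hω
      exact (hω.abs.add tendsto_const_nhds).sub (hω.sub tendsto_const_nhds).abs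
  have hlim0 : Tendsto (fun i => c i + ∫ ω, |g ω| ∂μ
      - ∫ ω, (|G i ω| + |g ω| - |G i ω - g ω|) ∂μ) l (𝓝 0) := by
    have h := (hc.add_const (∫ ω, |g ω| ∂μ)).sub key
    have h0 : ∫ ω, (|g ω| + |g ω| - |g ω - g ω|) ∂μ = ∫ ω, |g ω| ∂μ + ∫ ω, |g ω| ∂μ := by
      rw [← integral_add hg.abs hg.abs]
      simp
    rwa [h0, sub_self] at h
  refine squeeze_zero' (Eventually.of_forall fun i => integral_nonneg fun ω => abs_nonneg _) ?_
    hlim0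
  filter_upwards [hG, hle] with i hi hci
  have h1 : ∫ ω, (|G i ω| + |g ω| - |G i ω - g ω|) ∂μ
      = ∫ ω, |G i ω| ∂μ + ∫ ω, |g ω| ∂μ - ∫ ω, |G i ω - g ω| ∂μ := by
    rw [← integral_add hi.abs hg.abs]
    exact integral_sub (hi.abs.add hg.abs) (hi.sub hg).abs
  linarith

/-- `L¹` convergence of the integrands passes to integrals over sets whose indicators converge
pointwise. -/
lemma tendsto_setIntegral_of_tendsto_integral_abs_sub {ι : Type*} {l : Filter ι}
    [l.IsCountablyGenerated] {G : ι → Ω → ℝ} {g : Ω → ℝ} {A : ι → Set Ω} {A' : Set Ω}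
    (hA : ∀ i, MeasurableSet (A i)) (hA' : MeasurableSet A') (hG : ∀ i, Integrable (G i) μ)
    (hg : Integrable g μ) (hlim : Tendsto (fun i => ∫ ω, |G i ω - g ω| ∂μ) l (𝓝 0))
    (hev : ∀ ω, ∀ᶠ i in l, (ω ∈ A i ↔ ω ∈ A')) :
    Tendsto (fun i => ∫ ω in A i, G i ω ∂μ) l (𝓝 (∫ ω in A', g ω ∂μ)) := by
  have h1 : Tendsto (fun i => ∫ ω in A i, g ω ∂μ) l (𝓝 (∫ ω in A', g ω ∂μ)) := by
    simp only [← integral_indicator (hA _), ← integral_indicator hA']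
    refine tendsto_integral_filter_of_dominated_convergence (fun ω => ‖g ω‖)
      (Eventually.of_forall fun i => (hg.indicator (hA i)).aestronglyMeasurable)
      (Eventually.of_forall fun i => Eventually.of_forall fun ω => norm_indicator_le_norm_self _ _)
      hg.norm (Eventually.of_forall fun ω => tendsto_const_nhds.congr' ?_)
    filter_upwards [hev ω] with i hi
    by_cases h : ω ∈ A'
    · rw [indicator_of_mem h, indicator_of_mem (hi.2 h)]
    · rw [indicator_of_notMem h, indicator_of_notMem fun h' => h (hi.1 h')]
  have h2 : Tendsto (fun i => ∫ ω in A i, (G i ω - g ω) ∂μ) l (𝓝 0) := by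
    refine squeeze_zero_norm (fun i => ?_) hlim
    exact (norm_integral_le_integral_norm _).trans
      (setIntegral_le_integral ((hG i).sub hg).abs (Eventually.of_forall fun ω => abs_nonneg _))
  have h3 := h2.add h1
  rw [zero_add] at h3
  refine h3.congr fun i => ?_
  rw [integral_sub (hG i).integrableOn hg.integrableOn]
  ring

lemma dist_toL1_toL1 {f g : Ω → ℝ} (hf : Integrable f μ) (hg : Integrable g μ) :
    dist (hf.toL1 f) (hg.toL1 g) = ∫ ω, dist (f ω) (g ω) ∂μ := by
  rw [dist_eq_norm, ← Integrable.toL1_sub, L1.norm_of_fun_eq_integral_norm]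
  rfl

lemma integrable_slope (hint : ∀ t, Integrable (F t) μ) (s t : ℝ) :
    Integrable (fun ω => slope (fun r => F r ω) s t) μ := by
  simp only [slope_def_field]
  exact ((hint t).sub (hint s)).div_const _

lemma UniformlyAbsolutelyContinuous.toL1 [IsFiniteMeasure μ] {a b : ℝ}
    (hF : UniformlyAbsolutelyContinuous F a b) (hint : ∀ t, Integrable (F t) μ) :
    AbsolutelyContinuousOnInterval (fun t => (hint t).toL1 (F t)) a b := by
  rw [absolutelyContinuousOnInterval_iff]
  intro ε hε
  obtain ⟨δ, hδ, h⟩ := hF (ε / (μ.real univ + 1)) (by positivity)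
  refine ⟨δ, hδ, fun E hE hs => ?_⟩
  simp_rw [dist_toL1_toL1]
  rw [← integral_finsetSum _ fun i _ => show Integrable (fun ω => dist _ _) μ from
    ((hint (E.2 i).1).sub (hint (E.2 i).2)).norm]
  calc ∫ ω, ∑ i ∈ Finset.range E.1, dist (F (E.2 i).1 ω) (F (E.2 i).2 ω) ∂μ
      ≤ ∫ _, ε / (μ.real univ + 1) ∂μ :=
        integral_mono_of_nonneg
          (Eventually.of_forall fun ω => Finset.sum_nonneg fun _ _ => dist_nonneg)
          (integrable_const _) (Eventually.of_forall fun ω => (h E hE hs ω).le)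
    _ = μ.real univ * (ε / (μ.real univ + 1)) := by simp
    _ < (μ.real univ + 1) * (ε / (μ.real univ + 1)) := by gcongr; linarith
    _ = ε := by field

lemma UniformlyAbsolutelyContinuous.ae_differentiableAt [SFinite μ]
    (hF : UniformlyAbsolutelyContinuous F 0 T)
    (hdiff : MeasurableSet {p : Ω × ℝ | DifferentiableAt ℝ (fun t => F t p.1) p.2}) :
    ∀ᵐ s ∂volume.restrict (Ioo 0 T), ∀ᵐ ω ∂μ, DifferentiableAt ℝ (fun t => F t ω) s := by
  refine (Measure.ae_ae_comm (p := fun ω s => DifferentiableAt ℝ (fun t => F t ω) s) hdiff).1 ?_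
  refine Eventually.of_forall fun ω => ?_
  rw [ae_restrict_iff' measurableSet_Ioo]
  filter_upwards [(hF.apply ω).ae_differentiableAt] with s hs hs0
  exact hs (Icc_subset_uIcc (Ioo_subset_Icc_self hs0))

/-- The derivative is integrable on `Ω × [0, T]`. The map `t ↦ F t` into `L¹` is absolutely
continuous, hence of bounded variation; by Fatou's lemma the `L¹` norm of the derivative is almost
everywhere at most the derivative of the variation function. -/
lemma UniformlyAbsolutelyContinuous.integrable_deriv [IsFiniteMeasure μ] (hT : 0 ≤ T)
    (hF : UniformlyAbsolutelyContinuous F 0 T) (hint : ∀ t, Integrable (F t) μ)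
    (hdiff : MeasurableSet {p : Ω × ℝ | DifferentiableAt ℝ (fun t => F t p.1) p.2})
    (hderiv : Measurable fun p : Ω × ℝ => deriv (fun t => F t p.1) p.2) :
    Integrable (fun p : Ω × ℝ => deriv (fun t => F t p.1) p.2)
      (μ.prod (volume.restrict (Ioo 0 T))) := by
  set Φ : ℝ → Lp ℝ 1 μ := fun t => (hint t).toL1 (F t) with hΦ
  have hBV : BoundedVariationOn Φ (Icc 0 T) := by
    simpa only [uIcc_of_le hT] using (hF.toL1 hint).boundedVariationOn
  have hLBV := hBV.locallyBoundedVariationOn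
  set V : ℝ → ℝ := variationOnFromTo Φ (Icc 0 T) 0
  have h0T : (0 : ℝ) ∈ Icc 0 T := ⟨le_rfl, hT⟩
  have hVmono : MonotoneOn V (Icc 0 T) := variationOnFromTo.monotoneOn hLBV h0T
  have hVdist : ∀ x ∈ Icc 0 T, ∀ y ∈ Icc 0 T, x ≤ y →
      ∫ ω, |F y ω - F x ω| ∂μ ≤ V y - V x := by
    intro x hx y hy hxy
    have h1 : V y - V x = variationOnFromTo Φ (Icc 0 T) x y := by
      have := variationOnFromTo.add hLBV h0T hx hy
      simp only [V]
      linarith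
    have h2 : ∫ ω, |F y ω - F x ω| ∂μ = dist (Φ x) (Φ y) := by
      rw [dist_comm, hΦ, dist_toL1_toL1]; rfl
    rw [h1, h2, variationOnFromTo.eq_of_le _ _ hxy, dist_edist]
    exact ENNReal.toReal_mono (hLBV x y hx hy)
      (eVariationOn.edist_le _ ⟨hx, le_rfl, hxy⟩ ⟨hy, hxy, le_rfl⟩)
  have hV' : IntegrableOn (deriv V) (Ioo 0 T) := by
    have := (hVmono.mono (uIcc_of_le hT).subset).intervalIntegrable_deriv
    rw [intervalIntegrable_iff_integrableOn_Ioo_of_le hT] at this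
    exact this
  have hVdiff : ∀ᵐ s ∂volume.restrict (Ioo 0 T), DifferentiableAt ℝ V s := by
    rw [ae_restrict_iff' measurableSet_Ioo]
    filter_upwards [hVmono.ae_differentiableWithinAt_of_mem] with s hs hs0
    exact (hs (Ioo_subset_Icc_self hs0)).differentiableAt (Icc_mem_nhds hs0.1 hs0.2)
  refine ⟨hderiv.aestronglyMeasurable, ?_⟩
  rw [HasFiniteIntegral, lintegral_prod_symm (μ := μ) (ν := volume.restrict (Ioo 0 T)) _
    hderiv.enorm.aemeasurable]
  refine lt_of_le_of_lt (lintegral_mono_ae ?_) hV'.2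
  filter_upwards [hVdiff, hF.ae_differentiableAt (μ := μ) hdiff, ae_restrict_mem measurableSet_Ioo]
    with s hVs hFs hs
  -- the difference quotients along a sequence of steps decreasing to `0`
  obtain ⟨h, -, hpos, hlim⟩ := exists_seq_strictAnti_tendsto (0 : ℝ)
  have hseq : Tendsto (fun n => s + h n) atTop (𝓝[≠] s) := by
    refine tendsto_nhdsWithin_iff.2 ⟨by simpa using hlim.const_add s, ?_⟩
    exact Eventually.of_forall fun n => by simpa using (hpos n).ne'
  have hmem : ∀ᶠ n in atTop, s + h n ∈ Icc 0 T :=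
    (tendsto_nhds_of_tendsto_nhdsWithin hseq).eventually (Icc_mem_nhds hs.1 hs.2)
  have hVlim := ((hasDerivAt_iff_tendsto_slope.1 hVs.hasDerivAt).comp hseq).enorm
  calc ∫⁻ ω, ‖deriv (fun t => F t ω) s‖ₑ ∂μ
      = ∫⁻ ω, liminf (fun n => ‖slope (fun t => F t ω) s (s + h n)‖ₑ) atTop ∂μ := by
        refine lintegral_congr_ae ?_
        filter_upwards [hFs] with ω hω
        exact ((hasDerivAt_iff_tendsto_slope.1 hω.hasDerivAt).comp hseq).enorm.liminf_eq.symm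
    _ ≤ liminf (fun n => ∫⁻ ω, ‖slope (fun t => F t ω) s (s + h n)‖ₑ ∂μ) atTop := by
        refine lintegral_liminf_le' fun n => ?_
        exact (integrable_slope hint _ _).aestronglyMeasurable.enorm
    _ ≤ liminf (fun n => ‖slope V s (s + h n)‖ₑ) atTop := by
        refine liminf_le_liminf ?_
        filter_upwards [hmem] with n hn
        have hle : s ≤ s + h n := by linarith [hpos n]
        have h1 := hVdist s (Ioo_subset_Icc_self hs) _ hn hle
        rw [← ofReal_integral_norm_eq_lintegral_enorm (integrable_slope hint _ _), ← ofReal_norm]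
        refine ENNReal.ofReal_le_ofReal ?_
        simp only [slope_def_field, norm_div, Real.norm_eq_abs, add_sub_cancel_left]
        rw [integral_div]
        gcongr
        exact h1.trans (le_abs_self _)
    _ = ‖deriv V s‖ₑ := hVlim.liminf_eq

/-- At almost every time the difference quotients of a uniformly absolutely continuous family
converge in `L¹` to the derivative. -/
theorem UniformlyAbsolutelyContinuous.ae_tendsto_integral_abs_slope_sub_deriv [IsFiniteMeasure μ]
    (hT : 0 ≤ T) (hF : UniformlyAbsolutelyContinuous F 0 T) (hint : ∀ t, Integrable (F t) μ)
    (hdiff : MeasurableSet {p : Ω × ℝ | DifferentiableAt ℝ (fun t => F t p.1) p.2})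
    (hderiv : Measurable fun p : Ω × ℝ => deriv (fun t => F t p.1) p.2) :
    ∀ᵐ s ∂volume.restrict (Ioo 0 T),
      (∀ᵐ ω ∂μ, DifferentiableAt ℝ (fun t => F t ω) s) ∧
      Integrable (fun ω => deriv (fun t => F t ω) s) μ ∧
      Tendsto (fun t => ∫ ω, |slope (fun r => F r ω) s t - deriv (fun r => F r ω) s| ∂μ)
        (𝓝[≠] s) (𝓝 0) := by
  have hD := hF.integrable_deriv hT hint hdiff hderiv
  set e : ℝ → ℝ := fun s => ∫ ω, |deriv (fun t => F t ω) s| ∂μ with he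
  have hDint := (integrable_prod_iff' hD.aestronglyMeasurable).1 hD
  have heint : IntervalIntegrable e volume 0 T := by
    rw [intervalIntegrable_iff_integrableOn_Ioo_of_le hT]
    exact hDint.2
  -- the fundamental theorem of calculus along each path, integrated over `Ω`
  have hbound : ∀ x ∈ Icc 0 T, ∀ y ∈ Icc 0 T, x ≤ y →
      ∫ ω, |F y ω - F x ω| ∂μ ≤ ∫ s in x..y, e s := by
    intro x hx y hy hxy
    have hsub : uIcc x y ⊆ uIcc 0 T := by
      rw [uIcc_of_le hxy, uIcc_of_le hT]; exact Icc_subset_Icc hx.1 hy.2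
    have hprod : Integrable (fun p : Ω × ℝ => |deriv (fun t => F t p.1) p.2|)
        (μ.prod (volume.restrict (Ioc x y))) := by
      have h1 : (volume.restrict (Ioc x y)) ≤ volume.restrict (Ioo 0 T) := by
        rw [restrict_Ioo_eq_restrict_Ioc]
        exact Measure.restrict_mono (Ioc_subset_Ioc hx.1 hy.2) le_rfl
      refine (hD.mono_measure ?_).abs
      exact Measure.prod_mono le_rfl h1
    rw [intervalIntegral.integral_of_le hxy, he,
      ← integral_integral_swap (μ := μ) (ν := volume.restrict (Ioc x y))
        (f := fun ω s => |deriv (fun t => F t ω) s|) hprod]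
    refine integral_mono ((hint y).sub (hint x)).abs hprod.integral_prod_left fun ω => ?_
    have := ((hF.apply ω).mono hsub).integral_deriv_eq_sub
    simp only
    rw [← this, ← intervalIntegral.integral_of_le hxy]
    exact intervalIntegral.abs_integral_le_integral_abs hxy
  have hLeb := heint.ae_hasDerivAt_integral
  filter_upwards [hF.ae_differentiableAt (μ := μ) hdiff, hDint.1, ae_restrict_of_ae hLeb,
    ae_restrict_mem measurableSet_Ioo] with s hs1 hs2 hs3 hs
  refine ⟨hs1, hs2, ?_⟩
  have hsI := Ioo_subset_Icc_self hs
  have hder : HasDerivAt (fun x => ∫ t in s..x, e t) (e s) s := by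
    have h := uIcc_of_le hT ▸ hsI
    exact hs3 (by rwa [uIcc_of_le hT]) s (by rwa [uIcc_of_le hT])
  refine tendsto_integral_abs_sub_of_ae_tendsto
    (c := fun t => slope (fun x => ∫ t in s..x, e t) s t)
    (Eventually.of_forall fun t => integrable_slope hint _ _) hs2 ?_
    (hasDerivAt_iff_tendsto_slope.1 hder) ?_
  · filter_upwards [hs1] with ω hω
    exact hasDerivAt_iff_tendsto_slope.1 hω.hasDerivAt
  · have hnhds : ∀ᶠ t in 𝓝[≠] s, t ∈ Icc 0 T :=
      eventually_nhdsWithin_of_eventually_nhds (Icc_mem_nhds hs.1 hs.2)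
    filter_upwards [hnhds, self_mem_nhdsWithin] with t ht hne
    simp only [slope_def_field, abs_div, intervalIntegral.integral_same, sub_zero]
    rw [integral_div]
    rcases lt_or_gt_of_ne hne with hlt | hlt
    · have h1 := hbound t ht s hsI hlt.le
      have h2 := sub_pos.2 hlt
      rw [abs_of_neg (sub_neg.2 hlt), neg_sub, intervalIntegral.integral_symm,
        ← neg_sub s t, neg_div_neg_eq]
      simp_rw [abs_sub_comm (F t _)]
      gcongr
    · rw [abs_of_pos (sub_pos.2 hlt)]
      have := sub_pos.2 hlt
      gcongr
      exact hbound s hsI t ht hlt.le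

end L1Derivative

/-! ### Path space -/

section PathSpace

variable {m : ℕ}

lemma measurable_eval (t : ℝ≥0) : Measurable fun ω : CadlagPath m => ω t := by
  intro A _
  exact (le_iSup (fun t : ℝ≥0 => MeasurableSpace.comap (fun ω : CadlagPath m => ω t) ⊤) t) _
    ⟨A, trivial, rfl⟩

lemma measurable_of_measurable_eval {X : Type*} [MeasurableSpace X] {f : X → CadlagPath m}
    (hf : ∀ t, Measurable fun x => f x t) : Measurable f := by
  rw [measurable_iff_comap_le]
  change MeasurableSpace.comap f (⨆ t : ℝ≥0, _) ≤ _
  rw [MeasurableSpace.comap_iSup]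
  refine iSup_le fun t => ?_
  rw [MeasurableSpace.comap_comp]
  exact (hf t).comap_le

lemma measurableSet_eval_eq (t : ℝ≥0) (k : Fin m) :
    MeasurableSet {ω : CadlagPath m | ω t = k} :=
  measurable_eval t (measurableSet_singleton k)

/-- The path `ω` stopped at the deterministic time `s`. -/
def CadlagPath.stopAt (s : ℝ≥0) (ω : CadlagPath m) : CadlagPath m where
  toFun r := ω (min r s)
  right_continuous t := by
    refine (ω.right_continuous (min t s)).comp (t := Set.Ici (min t s))
      (f := fun r => min r s) (by fun_prop) fun r hr => ?_
    exact min_le_min_right s hr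
  left_limit t := by
    rcases le_or_gt t s with h | h
    · obtain ⟨l, hl⟩ := ω.left_limit t
      refine ⟨l, hl.congr' ?_⟩
      filter_upwards [self_mem_nhdsWithin] with r hr
      rw [min_eq_left (le_trans (le_of_lt hr) h)]
    · refine ⟨ω s, tendsto_const_nhds.congr' ?_⟩
      filter_upwards [mem_nhdsWithin_of_mem_nhds (Ioi_mem_nhds h)] with r hr
      rw [min_eq_right (le_of_lt hr)]

@[simp] lemma CadlagPath.stopAt_apply (s r : ℝ≥0) (ω : CadlagPath m) :
    (ω.stopAt s) r = ω (min r s) := rfl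

lemma measurable_stopAt (s : ℝ≥0) : Measurable (CadlagPath.stopAt (m := m) s) :=
  measurable_of_measurable_eval fun t => measurable_eval (min t s)

/-- The paths which agree with `c` at the finitely many times in `S`. -/
def cylinder (S : Finset ℝ≥0) (c : ℝ≥0 → Fin m) : Set (CadlagPath m) :=
  {ω | ∀ r ∈ S, ω r = c r}

lemma measurableSet_cylinder (S : Finset ℝ≥0) (c : ℝ≥0 → Fin m) :
    MeasurableSet (cylinder S c) := by
  have : cylinder S c = ⋂ r ∈ S, {ω : CadlagPath m | ω r = c r} := by
    ext ω; simp [cylinder]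
  rw [this]
  exact S.measurableSet_biInter fun r _ => measurableSet_eval_eq r _

/-- The finite-dimensional cylinders, with one prescribed state at each of finitely many times. -/
def cylinders (m : ℕ) : Set (Set (CadlagPath m)) := {A | ∃ S c, A = cylinder S c}

lemma isPiSystem_cylinders : IsPiSystem (cylinders m) := by
  rintro _ ⟨S, c, rfl⟩ _ ⟨S', c', rfl⟩ ⟨ω₀, h₀, h₀'⟩
  -- A point of the intersection serves as a common prescription for both cylinders.
  refine ⟨S ∪ S', ω₀, ?_⟩
  ext ω
  simp only [cylinder, Set.mem_inter_iff, Set.mem_ofPred_eq, Finset.mem_union]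
  constructor
  · rintro ⟨h, h'⟩ r (hr | hr)
    · rw [h r hr, h₀ r hr]
    · rw [h' r hr, h₀' r hr]
  · intro h
    exact ⟨fun r hr => (h r (Or.inl hr)).trans (h₀ r hr),
      fun r hr => (h r (Or.inr hr)).trans (h₀' r hr)⟩

lemma generateFrom_cylinders :
    (inferInstance : MeasurableSpace (CadlagPath m)) =
      MeasurableSpace.generateFrom (cylinders m) := by
  refine le_antisymm ?_ (MeasurableSpace.generateFrom_le ?_)
  · refine iSup_le fun t => ?_
    rintro _ ⟨A, -, rfl⟩
    have : (fun ω : CadlagPath m => ω t) ⁻¹' A = ⋃ k ∈ A, cylinder {t} (fun _ => k) := by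
      ext ω; simp [cylinder]
    rw [this]
    exact MeasurableSet.biUnion A.to_countable fun k _ =>
      MeasurableSpace.measurableSet_generateFrom ⟨_, _, rfl⟩
  · rintro _ ⟨S, c, rfl⟩
    exact measurableSet_cylinder S c

end PathSpace

/-! ### The Markov property for stopped paths -/

section Markov

variable {m : ℕ} {B : Matrix (Fin m) (Fin m) ℝ} {P : Measure (CadlagPath m)}

/-- The transition matrix `exp (-h B)`, for a time increment `h` of either sign. -/
noncomputable def transition (B : Matrix (Fin m) (Fin m) ℝ) (h : ℝ) : Matrix (Fin m) (Fin m) ℝ :=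
  NormedSpace.exp (-(h • B))

/-- The Markov property for a cylinder whose last time is `s`. The transition probability is
nonnegative because it equals a conditional probability. -/
lemma IsMarkovChain.measure_cylinder_inter [IsProbabilityMeasure P] (hP : IsMarkovChain B P)
    {S : Finset ℝ≥0} {s t : ℝ≥0} (hs : s ∈ S) (hmax : ∀ r ∈ S, r ≤ s) (hst : s < t)
    (c : ℝ≥0 → Fin m) (j : Fin m) (h0 : P (cylinder S c) ≠ 0) :
    0 ≤ transition B (t - s) (c s) j ∧ P (cylinder S c ∩ {ω | ω t = j}) =
      ENNReal.ofReal (transition B (t - s) (c s) j) * P (cylinder S c) := by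
  obtain ⟨k, hk⟩ : ∃ k, S.card = k + 1 :=
    Nat.exists_eq_succ_of_ne_zero (Finset.card_ne_zero_of_mem hs)
  set τ : Fin (k + 1) → ℝ≥0 := fun a => S.orderEmbOfFin hk a with hτ
  have hτmem : ∀ a, τ a ∈ S := fun a => S.orderEmbOfFin_mem hk a
  have hτlast : τ (Fin.last k) = s := by
    obtain ⟨a, ha⟩ : s ∈ Set.range τ := by rw [hτ, S.range_orderEmbOfFin hk]; exact hs
    refine le_antisymm (hmax _ (hτmem _)) ?_
    rw [← ha]
    exact (S.orderEmbOfFin hk).monotone (Fin.le_last a)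
  have hcyl : pathCylinder τ (fun a => c (τ a)) = cylinder S c := by
    ext ω
    constructor
    · intro h r hr
      obtain ⟨a, rfl⟩ : r ∈ Set.range τ := by rw [hτ, S.range_orderEmbOfFin hk]; exact hr
      exact h a
    · exact fun h a => h _ (hτmem a)
  have hmono : StrictMono (Fin.snoc τ t : Fin (k + 2) → ℝ≥0) := by
    intro a b hab
    induction b using Fin.lastCases with
    | last =>
      induction a using Fin.lastCases with
      | last => exact absurd hab (lt_irrefl _)
      | cast a => simpa using (hmax _ (hτmem a)).trans_lt hst
    | cast b =>
      induction a using Fin.lastCases with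
      | last => exact absurd hab (not_lt.2 (Fin.le_last _))
      | cast a =>
        simp only [Fin.snoc_castSucc]
        exact (S.orderEmbOfFin hk).strictMono (Fin.castSucc_lt_castSucc_iff.1 hab)
  have key := hP k (Fin.snoc τ t) (Fin.snoc (fun a => c (τ a)) j) hmono
  simp only [Fin.snoc_castSucc, Fin.snoc_last, hcyl, hτlast] at key
  specialize key h0
  have hC := measurableSet_cylinder S c
  have h1 : transition B (t - s) (c s) j = (P[|cylinder S c]).real {ω | ω t = j} := key.symm
  refine ⟨h1 ▸ measureReal_nonneg, ?_⟩
  rw [h1, ofReal_measureReal (by finiteness), cond_apply hC, mul_comm, ← mul_assoc,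
    ENNReal.mul_inv_cancel h0 (by finiteness), one_mul]

lemma IsMarkovChain.transition_nonneg [IsProbabilityMeasure P] (hP : IsMarkovChain B P)
    {s t : ℝ≥0} (hst : s < t) (k j : Fin m) (h0 : P {ω | ω s = k} ≠ 0) :
    0 ≤ transition B (t - s) k j := by
  have h : cylinder {s} (fun _ => k) = {ω : CadlagPath m | ω s = k} := by ext; simp [cylinder]
  exact (hP.measure_cylinder_inter (S := {s}) (by simp) (by simp) hst (fun _ => k) j
    (by rwa [h])).1

/-- The Markov property for events that depend on the path up to time `s` only. -/
lemma IsMarkovChain.measure_stopAt_preimage_inter [IsProbabilityMeasure P] (hP : IsMarkovChain B P)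
    {s t : ℝ≥0} (hst : s < t) (k j : Fin m) {A : Set (CadlagPath m)} (hA : MeasurableSet A) :
    P (CadlagPath.stopAt s ⁻¹' A ∩ ({ω | ω s = k} ∩ {ω | ω t = j})) =
      ENNReal.ofReal (transition B (t - s) k j) * P (CadlagPath.stopAt s ⁻¹' A ∩ {ω | ω s = k}) := by
  have hst_meas := measurable_stopAt (m := m) s
  have hcyl : ∀ S c, P (CadlagPath.stopAt s ⁻¹' (cylinder S c) ∩ ({ω | ω s = k} ∩ {ω | ω t = j})) =
      ENNReal.ofReal (transition B (t - s) k j) *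
        P (CadlagPath.stopAt s ⁻¹' (cylinder S c) ∩ {ω | ω s = k}) := by
    intro S c
    rw [← Set.inter_assoc]
    by_cases h0 : P (CadlagPath.stopAt s ⁻¹' (cylinder S c) ∩ {ω | ω s = k}) = 0
    · rw [h0, mul_zero]
      exact measure_mono_null Set.inter_subset_left h0
    obtain ⟨ω₀, h₀, hk⟩ := nonempty_of_measure_ne_zero h0
    have heq : CadlagPath.stopAt s ⁻¹' (cylinder S c) ∩ {ω | ω s = k} =
        cylinder (insert s (S.image fun r => min r s)) ω₀ := by
      ext ω
      simp only [cylinder, Set.mem_inter_iff, Set.mem_preimage, Set.mem_ofPred_eq,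
        CadlagPath.stopAt_apply, Finset.mem_insert, Finset.mem_image] at h₀ hk ⊢
      constructor
      · rintro ⟨h1, h2⟩ r (rfl | ⟨r', hr', rfl⟩)
        · rw [h2, hk]
        · rw [h1 r' hr', h₀ r' hr']
      · intro h
        refine ⟨fun r hr => ?_, (h s (Or.inl rfl)).trans hk⟩
        rw [h _ (Or.inr ⟨r, hr, rfl⟩), h₀ r hr]
    rw [heq] at h0 ⊢
    have hk' : ω₀ s = k := hk
    rw [← hk']
    refine (hP.measure_cylinder_inter (Finset.mem_insert_self _ _) ?_ hst ω₀ j h0).2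
    intro r hr
    rcases Finset.mem_insert.1 hr with rfl | hr
    · exact le_rfl
    · obtain ⟨r', -, rfl⟩ := Finset.mem_image.1 hr
      exact min_le_right _ _
  have hmeas : (P.restrict ({ω | ω s = k} ∩ {ω | ω t = j})).map (CadlagPath.stopAt s) =
      ENNReal.ofReal (transition B (t - s) k j) •
        (P.restrict {ω | ω s = k}).map (CadlagPath.stopAt s) := by
    have hfin : ∀ D, MeasurableSet D →
        ((P.restrict ({ω | ω s = k} ∩ {ω | ω t = j})).map (CadlagPath.stopAt s) D =
          (ENNReal.ofReal (transition B (t - s) k j) •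
            (P.restrict {ω | ω s = k}).map (CadlagPath.stopAt s)) D ↔
        P (CadlagPath.stopAt s ⁻¹' D ∩ ({ω | ω s = k} ∩ {ω | ω t = j})) =
          ENNReal.ofReal (transition B (t - s) k j) *
            P (CadlagPath.stopAt s ⁻¹' D ∩ {ω | ω s = k})) := by
      intro D hD
      rw [Measure.smul_apply, Measure.map_apply hst_meas hD, Measure.map_apply hst_meas hD,
        Measure.restrict_apply (hst_meas hD), Measure.restrict_apply (hst_meas hD), smul_eq_mul]
    refine ext_of_generate_finite (cylinders m) generateFrom_cylinders isPiSystem_cylinders ?_ ?_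
    · rintro _ ⟨S, c, rfl⟩
      exact (hfin _ (measurableSet_cylinder S c)).2 (hcyl S c)
    · have : (Set.univ : Set (CadlagPath m)) = cylinder ∅ fun _ => k := by ext; simp [cylinder]
      rw [this]
      exact (hfin _ (measurableSet_cylinder _ _)).2 (hcyl _ _)
  have := congrArg (fun ν => ν A) hmeas
  simpa only [Measure.smul_apply, Measure.map_apply hst_meas hA,
    Measure.restrict_apply (hst_meas hA), smul_eq_mul] using this

lemma IsMarkovChain.map_stopAt_restrict_condStart [IsProbabilityMeasure P] (hP : IsMarkovChain B P)
    {s t : ℝ≥0} (hst : s < t) (i k j : Fin m) :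
    ((condStart P i).restrict ({ω | ω s = k} ∩ {ω | ω t = j})).map (CadlagPath.stopAt s) =
      ENNReal.ofReal (transition B (t - s) k j) •
        ((condStart P i).restrict {ω | ω s = k}).map (CadlagPath.stopAt s) := by
  have hst_meas := measurable_stopAt (m := m) s
  ext D hD
  have h0 := measurableSet_eval_eq (m := m) 0 i
  -- The initial state is determined by the stopped path.
  have hpre : {ω : CadlagPath m | ω 0 = i} = CadlagPath.stopAt s ⁻¹' {ω | ω 0 = i} := by
    ext ω; simp
  rw [Measure.smul_apply, Measure.map_apply hst_meas hD, Measure.map_apply hst_meas hD,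
    Measure.restrict_apply (hst_meas hD), Measure.restrict_apply (hst_meas hD), smul_eq_mul,
    condStart, cond_apply h0, cond_apply h0, hpre, ← Set.inter_assoc,
    ← Set.inter_assoc _ (CadlagPath.stopAt s ⁻¹' D), ← Set.preimage_inter,
    hP.measure_stopAt_preimage_inter hst k j (h0.inter hD)]
  ring

instance (P : Measure (CadlagPath m)) [IsProbabilityMeasure P] (i : Fin m) :
    IsFiniteMeasure (condStart P i) := by
  unfold condStart; infer_instance

lemma sum_setIntegral_eval_eq {μ : Measure (CadlagPath m)} (t : ℝ≥0) {f : CadlagPath m → ℝ}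
    (hf : Integrable f μ) : ∫ ω, f ω ∂μ = ∑ k, ∫ ω in {ω | ω t = k}, f ω ∂μ := by
  rw [← integral_iUnion_fintype (fun k => measurableSet_eval_eq t k) ?_ fun k => hf.integrableOn]
  · have : ⋃ k, {ω : CadlagPath m | ω t = k} = Set.univ := by ext; simp
    rw [this, setIntegral_univ]
  · intro k k' hne
    exact Set.disjoint_left.2 fun ω h h' => hne (h.symm.trans h')

lemma setIntegral_eval_comp {μ : Measure (CadlagPath m)} (t : ℝ≥0)
    (f : CadlagPath m → Fin m → ℝ) (k : Fin m) :
    ∫ ω in {ω | ω t = k}, f ω (ω t) ∂μ = ∫ ω in {ω | ω t = k}, f ω k ∂μ :=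
  setIntegral_congr_fun (measurableSet_eval_eq t k) fun ω (h : ω t = k) => by simp only [h]

lemma integrable_eval_comp {μ : Measure (CadlagPath m)} (t : ℝ≥0) {f : CadlagPath m → Fin m → ℝ}
    (hf : ∀ j, Integrable (fun ω => f ω j) μ) : Integrable (fun ω => f ω (ω t)) μ := by
  have : (fun ω => f ω (ω t)) =
      fun ω => ∑ j, {ω : CadlagPath m | ω t = j}.indicator (fun ω => f ω j) ω := by
    ext ω
    simp [Set.indicator_apply]
  rw [this]
  exact integrable_finsetSum _ fun j _ => (hf j).indicator (measurableSet_eval_eq t j)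

lemma integrable_mulVec_eval {μ : Measure (CadlagPath m)} (A : Matrix (Fin m) (Fin m) ℝ)
    (s : ℝ≥0) {v : CadlagPath m → Fin m → ℝ} (hv : ∀ j, Integrable (fun ω => v ω j) μ) :
    Integrable (fun ω => (A *ᵥ v ω) (ω s)) μ :=
  integrable_eval_comp s fun k => show Integrable (fun ω => ∑ j, A k j * v ω j) μ from
    integrable_finsetSum _ fun j _ => (hv j).const_mul _

lemma integral_mulVec_eval {μ : Measure (CadlagPath m)} (A : Matrix (Fin m) (Fin m) ℝ)
    (s : ℝ≥0) {v : CadlagPath m → Fin m → ℝ} (hv : ∀ j, Integrable (fun ω => v ω j) μ) :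
    ∫ ω, (A *ᵥ v ω) (ω s) ∂μ = ∑ k, ∑ j, A k j * ∫ ω in {ω | ω s = k}, v ω j ∂μ := by
  rw [sum_setIntegral_eval_eq s (integrable_mulVec_eval A s hv)]
  refine Finset.sum_congr rfl fun k _ => ?_
  rw [setIntegral_eval_comp s (fun ω => A *ᵥ v ω)]
  simp only [mulVec, dotProduct]
  rw [integral_finsetSum _ fun j _ => ((hv j).restrict).const_mul _]
  simp only [integral_const_mul]

/-- The Markov property for integrands that depend on the path up to time `s` only. -/
theorem IsMarkovChain.integral_eval_comp [IsProbabilityMeasure P] (hP : IsMarkovChain B P)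
    (i : Fin m) {s t : ℝ≥0} (hst : s < t) {v : CadlagPath m → Fin m → ℝ}
    (hv_inv : ∀ ω, v (ω.stopAt s) = v ω) (hmeas : ∀ j, Measurable fun ω => v ω j)
    (hint : ∀ j, Integrable (fun ω => v ω j) (condStart P i)) :
    ∫ ω, v ω (ω t) ∂condStart P i =
      ∫ ω, (transition B (t - s) *ᵥ v ω) (ω s) ∂condStart P i := by
  have hsing : ∀ k j, ∫ ω in {ω | ω s = k} ∩ {ω | ω t = j}, v ω j ∂condStart P i =
      transition B (t - s) k j * ∫ ω in {ω | ω s = k}, v ω j ∂condStart P i := by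
    intro k j
    have hmap : ∀ D, ∫ ω in D, v ω j ∂condStart P i =
        ∫ ω, v ω j ∂((condStart P i).restrict D).map (CadlagPath.stopAt s) := by
      intro D
      rw [integral_map (measurable_stopAt s).aemeasurable (hmeas j).aestronglyMeasurable]
      simp only [hv_inv]
    rw [hmap, hmap, hP.map_stopAt_restrict_condStart hst, integral_smul_measure, smul_eq_mul]
    -- On a null event nothing is known about the sign of the transition matrix entry.
    by_cases h0 : P {ω | ω s = k} = 0
    · have : (condStart P i).restrict {ω | ω s = k} = 0 :=
        Measure.restrict_eq_zero.2 (cond_absolutelyContinuous h0)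
      simp [this]
    · rw [ENNReal.toReal_ofReal (hP.transition_nonneg hst k j h0)]
  rw [integral_mulVec_eval _ _ hint, sum_setIntegral_eval_eq s (integrable_eval_comp t hint)]
  refine Finset.sum_congr rfl fun k _ => ?_
  rw [sum_setIntegral_eval_eq t (integrable_eval_comp t hint).restrict]
  refine Finset.sum_congr rfl fun j _ => ?_
  rw [setIntegral_eval_comp t v, Measure.restrict_restrict (measurableSet_eval_eq t j),
    Set.inter_comm, hsing]

lemma hasDerivAt_transition_zero (k j : Fin m) :
    HasDerivAt (fun h => transition B h k j) (-B k j) 0 := by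
  let _ := Matrix.linftyOpNormedRing (n := Fin m) (α := ℝ)
  let _ := Matrix.linftyOpNormedAlgebra (n := Fin m) (R := ℝ) (α := ℝ)
  have h := hasDerivAt_exp_smul_const (𝕂 := ℝ) (-B) (0 : ℝ)
  simp only [zero_smul, smul_neg, neg_zero, NormedSpace.exp_zero, one_mul] at h
  have h2 := hasDerivAt_pi.1 (hasDerivAt_pi.1 h k) j
  exact h2

lemma transition_mulVec_neg (h : ℝ) (v : Fin m → ℝ) :
    transition B h *ᵥ (transition B (-h) *ᵥ v) = v := by
  have : transition B h * transition B (-h) = 1 := by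
    simp only [transition, neg_smul]
    rw [← Matrix.exp_add_of_commute _ _
      (((Commute.refl B).smul_left h).smul_right h).neg_left.neg_right.neg_right]
    simp
  rw [mulVec_mulVec, this, one_mulVec]

end Markov

/-! ### Functions along admissible curves -/

section Curve

open AbsolutelyContinuousOnInterval

variable {m N : ℕ} {γ : CadlagPath m → C(ℝ≥0, EuclideanSpace ℝ (Fin N))}

lemma IsAdmissibleCurve.apply_stopAt (hγ : IsAdmissibleCurve γ) {s t : ℝ≥0} (hts : t ≤ s)
    (ω : CadlagPath m) : γ (ω.stopAt s) t = γ ω t :=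
  hγ.nonanticipating s (ω.stopAt s) ω (fun r hr => by simp [min_eq_left hr]) t hts

/-- Admissible curves are bounded on `[0, T]` uniformly in `ω`: the starting point depends on
`ω 0` only, hence takes finitely many values. -/
lemma IsAdmissibleCurve.exists_norm_le (hγ : IsAdmissibleCurve γ) (T : ℝ≥0) :
    ∃ R : ℝ, ∀ ω, ∀ t ≤ T, ‖γ ω t‖ ≤ R := by
  obtain ⟨R₀, hR₀⟩ : ∃ R₀ : ℝ, ∀ ω, ‖γ ω 0‖ ≤ R₀ := by
    have hfac : Function.FactorsThrough (fun ω => ‖γ ω 0‖) (fun ω : CadlagPath m => ω 0) := by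
      intro ω₁ ω₂ h
      simp only
      rw [hγ.nonanticipating 0 ω₁ ω₂ (fun s hs => by rwa [nonpos_iff_eq_zero.1 hs]) 0 le_rfl]
    obtain ⟨g, hg⟩ := (Function.factorsThrough_iff _).1 hfac
    obtain ⟨R₀, hR₀⟩ := (Set.finite_range g).bddAbove
    exact ⟨R₀, fun ω => hR₀ ⟨ω 0, (congrFun hg ω).symm⟩⟩
  obtain ⟨δ, hδ, h⟩ := hγ.equi_absolutely_continuous T 1 one_pos
  obtain ⟨n, hn⟩ := exists_nat_gt ((T : ℝ) / δ)
  have hn0 : (0 : ℝ) < n := lt_of_le_of_lt (by positivity) hn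
  have hn0' : (n : ℝ≥0) ≠ 0 := by exact_mod_cast hn0.ne'
  refine ⟨R₀ + n, fun ω t ht => ?_⟩
  -- `[0, t]` is cut into `n` intervals of length `t / n < δ`.
  set p : ℕ → ℝ≥0 := fun k => k * (t / n) with hp
  have hpn : p n = t := by simp only [hp]; field_simp
  have hp0 : p 0 = 0 := by simp [hp]
  have hpmono : Monotone p := fun a b hab => by simp only [hp]; gcongr
  have hstep : ∀ k < n, dist (γ ω (p k)) (γ ω (p (k + 1))) ≤ 1 := by
    intro k hk
    have hle : p (k + 1) ≤ T := (hpmono hk).trans (hpn.le.trans ht)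
    have hlen : (p (k + 1) : ℝ) - p k < δ := by
      have h1 : (p (k + 1) : ℝ) - p k = t / n := by simp only [hp]; push_cast; ring
      have h2 : (t : ℝ) ≤ T := by exact_mod_cast ht
      rw [h1, div_lt_iff₀ hn0]
      rw [div_lt_iff₀ hδ] at hn
      linarith
    have := h 1 (fun _ => p k) (fun _ => p (k + 1)) (fun _ => hpmono (Nat.le_succ k))
      (fun _ => hle) (fun a b hab => absurd (Subsingleton.elim a b) hab) (by simpa using hlen) ω
    rw [dist_comm, dist_eq_norm]
    simpa using this.le
  have hsum : dist (γ ω 0) (γ ω t) ≤ n := by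
    have h1 := dist_le_range_sum_dist (fun k => γ ω (p k)) n
    rw [hp0, hpn] at h1
    refine h1.trans ((Finset.sum_le_sum fun k hk => hstep k (Finset.mem_range.1 hk)).trans ?_)
    simp
  have h2 : ‖γ ω t‖ ≤ ‖γ ω 0‖ + ‖γ ω t - γ ω 0‖ := by
    simpa using norm_add_le (γ ω 0) (γ ω t - γ ω 0)
  rw [dist_comm, dist_eq_norm] at hsum
  linarith [hR₀ ω]

/-- The `j`-th component of `u` along the curve `γ`, for times in `ℝ`; negative times are
replaced by `0`. -/
def alongCurve (u : ℝ≥0 × EuclideanSpace ℝ (Fin N) → (Fin m → ℝ))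
    (γ : CadlagPath m → C(ℝ≥0, EuclideanSpace ℝ (Fin N))) (j : Fin m) (t : ℝ)
    (ω : CadlagPath m) : ℝ :=
  u (t.toNNReal, γ ω t.toNNReal) j

variable {u : ℝ≥0 × EuclideanSpace ℝ (Fin N) → (Fin m → ℝ)}

lemma continuous_uncurry_alongCurve (hu : LocallyLipschitz u) (j : Fin m) :
    Continuous (Function.uncurry fun (c : C(ℝ≥0, EuclideanSpace ℝ (Fin N))) (t : ℝ) =>
      u (t.toNNReal, c t.toNNReal) j) := by
  have hu' := hu.continuous
  fun_prop

lemma continuous_alongCurve (hu : LocallyLipschitz u) (j : Fin m) (ω : CadlagPath m) :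
    Continuous fun t => alongCurve u γ j t ω :=
  (continuous_uncurry_alongCurve hu j).comp (Continuous.prodMk_right (γ ω))

lemma IsAdmissibleCurve.measurable_alongCurve (hγ : IsAdmissibleCurve γ) (hu : LocallyLipschitz u)
    (j : Fin m) (t : ℝ) : Measurable (alongCurve u γ j t) := by
  borelize C(ℝ≥0, EuclideanSpace ℝ (Fin N))
  exact ((continuous_uncurry_alongCurve hu j).comp
    (Continuous.prodMk_left t)).measurable.comp hγ.measurable

lemma IsAdmissibleCurve.measurable_prodMap (hγ : IsAdmissibleCurve γ) :
    Measurable[_, @Prod.instMeasurableSpace _ _ (borel _) _]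
      fun p : CadlagPath m × ℝ => (γ p.1, p.2) := by
  borelize C(ℝ≥0, EuclideanSpace ℝ (Fin N))
  exact (hγ.measurable.comp measurable_fst).prodMk measurable_snd

/-- The curve enters through the space of continuous functions, on which the parameter dependence
is jointly continuous. -/
lemma IsAdmissibleCurve.measurableSet_differentiableAt (hγ : IsAdmissibleCurve γ)
    (hu : LocallyLipschitz u) (j : Fin m) :
    MeasurableSet {p : CadlagPath m × ℝ |
      DifferentiableAt ℝ (fun t => alongCurve u γ j t p.1) p.2} := by
  borelize C(ℝ≥0, EuclideanSpace ℝ (Fin N))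
  exact hγ.measurable_prodMap (measurableSet_of_differentiableAt_with_param ℝ
    (continuous_uncurry_alongCurve hu j))

lemma IsAdmissibleCurve.measurable_deriv_alongCurve (hγ : IsAdmissibleCurve γ)
    (hu : LocallyLipschitz u) (j : Fin m) :
    Measurable fun p : CadlagPath m × ℝ => deriv (fun t => alongCurve u γ j t p.1) p.2 := by
  borelize C(ℝ≥0, EuclideanSpace ℝ (Fin N))
  exact (measurable_deriv_with_param (continuous_uncurry_alongCurve hu j)).comp
    hγ.measurable_prodMap

lemma IsAdmissibleCurve.alongCurve_stopAt (hγ : IsAdmissibleCurve γ) {s : ℝ≥0} {t : ℝ}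
    (hts : t.toNNReal ≤ s) (j : Fin m) (ω : CadlagPath m) :
    alongCurve u γ j t (ω.stopAt s) = alongCurve u γ j t ω := by
  rw [alongCurve, alongCurve, hγ.apply_stopAt hts]

/-- The range of an admissible curve over `[0, T]` is contained in a compact set, on which `u` is
bounded and Lipschitz. -/
lemma IsAdmissibleCurve.exists_bound_lipschitz (hγ : IsAdmissibleCurve γ)
    (hu : LocallyLipschitz u) (T : ℝ≥0) :
    (∃ M : ℝ, ∀ j ω, ∀ t ≤ (T : ℝ), |alongCurve u γ j t ω| ≤ M) ∧
    ∃ L : ℝ≥0, ∀ j ω, ∀ s ≤ (T : ℝ), ∀ t ≤ (T : ℝ),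
      |alongCurve u γ j t ω - alongCurve u γ j s ω| ≤
        L * (dist t s + ‖γ ω t.toNNReal - γ ω s.toNNReal‖) := by
  obtain ⟨R, hR⟩ := hγ.exists_norm_le T
  set K : Set (ℝ≥0 × EuclideanSpace ℝ (Fin N)) := Set.Icc 0 T ×ˢ Metric.closedBall 0 R
  have hK : IsCompact K := isCompact_Icc.prod (isCompact_closedBall _ _)
  have hmem : ∀ ω, ∀ t ≤ (T : ℝ), (t.toNNReal, γ ω t.toNNReal) ∈ K := by
    intro ω t ht
    have ht' : t.toNNReal ≤ T := Real.toNNReal_le_iff_le_coe.2 ht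
    exact ⟨⟨zero_le, ht'⟩, by simpa using hR ω _ ht'⟩
  obtain ⟨M, hM⟩ := hK.exists_bound_of_continuousOn hu.continuous.continuousOn
  obtain ⟨L, hL⟩ := (hu.locallyLipschitzOn (s := K)).exists_lipschitzOnWith_of_compact hK
  refine ⟨⟨M, fun j ω t ht => (norm_le_pi_norm _ j).trans (hM _ (hmem ω t ht))⟩, L,
    fun j ω s hs t ht => ?_⟩
  have h1 := hL.dist_le_mul _ (hmem ω t ht) _ (hmem ω s hs)
  have h2 := dist_le_pi_dist (u (t.toNNReal, γ ω t.toNNReal)) (u (s.toNNReal, γ ω s.toNNReal)) j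
  refine (h2.trans h1).trans ?_
  gcongr
  rw [Prod.dist_eq]
  refine max_le ?_ ?_
  · refine le_add_of_le_of_nonneg ?_ (norm_nonneg _)
    have := Real.lipschitzWith_toNNReal.dist_le_mul t s
    simpa using this
  · rw [dist_eq_norm]
    exact le_add_of_nonneg_left dist_nonneg

lemma IsAdmissibleCurve.integrable_alongCurve (hγ : IsAdmissibleCurve γ)
    (hu : LocallyLipschitz u) (j : Fin m) (t : ℝ) (μ : Measure (CadlagPath m))
    [IsFiniteMeasure μ] : Integrable (alongCurve u γ j t) μ := by
  obtain ⟨⟨M, hM⟩, -⟩ := hγ.exists_bound_lipschitz hu t.toNNReal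
  exact .of_bound (hγ.measurable_alongCurve hu j t).aestronglyMeasurable M
    (Eventually.of_forall fun ω => hM j ω t (Real.le_coe_toNNReal t))

/-- `u` is Lipschitz on the compact set visited by the curve, so it inherits the uniform modulus
of absolute continuity of the curve. -/
lemma IsAdmissibleCurve.uniformlyAbsolutelyContinuous_alongCurve (hγ : IsAdmissibleCurve γ)
    (hu : LocallyLipschitz u) (j : Fin m) (T : ℝ≥0) :
    UniformlyAbsolutelyContinuous (alongCurve u γ j) 0 T := by
  obtain ⟨-, L, hL⟩ := hγ.exists_bound_lipschitz hu T
  intro ε hε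
  obtain ⟨δ, hδ, h⟩ := hγ.equi_absolutely_continuous T (ε / (2 * (L + 1))) (by positivity)
  refine ⟨min δ (ε / (2 * (L + 1))), lt_min hδ (by positivity), ?_⟩
  rintro ⟨n, I⟩ ⟨hmem, hdisj⟩ hlen ω
  simp only [Set.uIcc_of_le T.coe_nonneg, Finset.mem_range] at hmem hdisj hlen ⊢
  have hsum : ∑ i ∈ Finset.range n, ‖γ ω (I i).1.toNNReal - γ ω (I i).2.toNNReal‖ <
      ε / (2 * (L + 1)) := by
    -- Each pair of endpoints is put in increasing order.
    set a : Fin n → ℝ≥0 := fun i => (min (I i).1 (I i).2).toNNReal with ha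
    set b : Fin n → ℝ≥0 := fun i => (max (I i).1 (I i).2).toNNReal with hb
    have hmin : ∀ i : Fin n, 0 ≤ min (I i).1 (I i).2 := fun i =>
      le_min (hmem i i.2).1.1 (hmem i i.2).2.1
    have hmax : ∀ i : Fin n, 0 ≤ max (I i).1 (I i).2 := fun i =>
      (hmin i).trans min_le_max
    have hIoo : ∀ (i : Fin n) (x : ℝ≥0), x ∈ Set.Ioo (a i) (b i) →
        (x : ℝ) ∈ Set.uIoc (I i).1 (I i).2 := by
      rintro i x ⟨h1, h2⟩
      exact ⟨(Real.toNNReal_lt_iff_lt_coe (hmin i)).1 h1,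
        (Real.lt_toNNReal_iff_coe_lt.1 h2).le⟩
    have := h n a b (fun i => Real.toNNReal_le_toNNReal min_le_max)
      (fun i => Real.toNNReal_le_iff_le_coe.2 (max_le (hmem i i.2).1.2 (hmem i i.2).2.2))
      (fun i k hik => Set.disjoint_left.2 fun x hx hx' => Set.disjoint_left.1
        (hdisj (Finset.mem_coe.2 (Finset.mem_range.2 i.2))
          (Finset.mem_coe.2 (Finset.mem_range.2 k.2)) fun h => hik (Fin.ext h))
        (hIoo i x hx) (hIoo k x hx')) ?_ ω
    · rw [Finset.sum_range]
      refine lt_of_eq_of_lt (Finset.sum_congr rfl fun i _ => ?_) this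
      rcases le_total (I i).1 (I i).2 with hle | hle
      · simp only [ha, hb, min_eq_left hle, max_eq_right hle]
        exact norm_sub_rev _ _
      · simp only [ha, hb, min_eq_right hle, max_eq_left hle]
    · refine lt_of_eq_of_lt ?_ (hlen.trans_le (min_le_left _ _))
      rw [Finset.sum_range]
      refine Finset.sum_congr rfl fun i _ => ?_
      simp only [ha, hb]
      rw [Real.coe_toNNReal _ (hmin i), Real.coe_toNNReal _ (hmax i), max_sub_min_eq_abs,
        Real.dist_eq, abs_sub_comm]
  have hlen' := hlen.trans_le (min_le_right _ _)
  have hL0 : (0 : ℝ) ≤ L := L.2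
  calc ∑ i ∈ Finset.range n, dist (alongCurve u γ j (I i).1 ω) (alongCurve u γ j (I i).2 ω)
      ≤ ∑ i ∈ Finset.range n, L * (dist (I i).1 (I i).2 +
          ‖γ ω (I i).1.toNNReal - γ ω (I i).2.toNNReal‖) :=
        Finset.sum_le_sum fun i hi => hL j ω _ (hmem i (Finset.mem_range.1 hi)).2.2 _
          (hmem i (Finset.mem_range.1 hi)).1.2
    _ = L * (∑ i ∈ Finset.range n, dist (I i).1 (I i).2 +
          ∑ i ∈ Finset.range n, ‖γ ω (I i).1.toNNReal - γ ω (I i).2.toNNReal‖) := by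
        rw [← Finset.mul_sum, Finset.sum_add_distrib]
    _ ≤ L * (ε / (2 * (L + 1)) + ε / (2 * (L + 1))) := by gcongr
    _ < (L + 1) * (ε / (2 * (L + 1)) + ε / (2 * (L + 1))) := by gcongr; linarith
    _ = ε := by field

end Curve

/-! ### The derivative of the expectation -/

section Expectation

variable {m N : ℕ} {B : Matrix (Fin m) (Fin m) ℝ} {P : Measure (CadlagPath m)}
  {γ : CadlagPath m → C(ℝ≥0, EuclideanSpace ℝ (Fin N))}
  {u : ℝ≥0 × EuclideanSpace ℝ (Fin N) → (Fin m → ℝ)}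

/-- The increment of the expectation, split into the switching part and the transport part. For
`t < s` the Markov property is applied to `exp (hB) v`, where `h = s - t` and `v` is the value at
time `t`; as `exp (-hB) (exp (hB) v) = v`, this moves the state in the switching part from `ω t` to
`ω s`. -/
lemma IsAdmissibleCurve.integral_increment [IsProbabilityMeasure P] (hP : IsMarkovChain B P)
    (hγ : IsAdmissibleCurve γ) (hu : LocallyLipschitz u) (i : Fin m) {s t : ℝ≥0} (hne : t ≠ s) :
    ∫ ω, alongCurve u γ (ω t) t ω ∂condStart P i - ∫ ω, alongCurve u γ (ω s) s ω ∂condStart P i =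
      ∫ ω, ((transition B (t - s) - 1) *ᵥ fun j => alongCurve u γ j (min s t : ℝ≥0) ω) (ω s)
        ∂condStart P i +
      ∫ ω, (alongCurve u γ (ω (max s t)) t ω - alongCurve u γ (ω (max s t)) s ω)
        ∂condStart P i := by
  have hint : ∀ (r : ℝ) j, Integrable (fun ω => alongCurve u γ j r ω) (condStart P i) :=
    fun r j => hγ.integrable_alongCurve hu j r _
  have heval : ∀ (r : ℝ) (a : ℝ≥0),
      Integrable (fun ω => alongCurve u γ (ω a) r ω) (condStart P i) :=
    fun r a => integrable_eval_comp (f := fun ω j => alongCurve u γ j r ω) a (hint r)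
  have hmeas : ∀ (r : ℝ) j, Measurable fun ω => alongCurve u γ j r ω :=
    fun r j => hγ.measurable_alongCurve hu j r
  simp only [sub_mulVec, one_mulVec, Pi.sub_apply]
  rw [integral_sub (integrable_mulVec_eval _ s (hint _)) (heval _ s),
    integral_sub (heval _ _) (heval _ _)]
  rcases lt_or_gt_of_ne hne with h | h
  · have key := hP.integral_eval_comp i h
      (v := fun ω => transition B (t - s) *ᵥ fun j => alongCurve u γ j t ω)
      (fun ω => by simp only [hγ.alongCurve_stopAt (t := t) (s := t) (by simp)])
      (fun j => show Measurable fun ω => ∑ k, transition B (t - s) j k * alongCurve u γ k t ω from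
        Finset.measurable_fun_sum _ fun k _ => (hmeas t k).const_mul _)
      (fun j => show Integrable (fun ω => ∑ k, transition B (t - s) j k * alongCurve u γ k t ω) _
        from integrable_finsetSum _ fun k _ => (hint t k).const_mul _)
    have h2 : ∀ v : Fin m → ℝ, transition B (s - t) *ᵥ (transition B (t - s) *ᵥ v) = v := by
      intro v
      rw [← neg_sub (s : ℝ) t]
      exact transition_mulVec_neg _ v
    simp only [h2] at key
    rw [min_eq_right h.le, max_eq_left h.le, key]
    ring
  · have key := hP.integral_eval_comp i h (v := fun ω j => alongCurve u γ j s ω)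
      (fun ω => by simp only [hγ.alongCurve_stopAt (t := s) (s := s) (by simp)]) (hmeas s) (hint s)
    rw [min_eq_left h.le, max_eq_right h.le, key]
    ring

/-- The switching part contributes `-B u`, at every time. -/
lemma IsAdmissibleCurve.tendsto_switching_part [IsProbabilityMeasure P]
    (hγ : IsAdmissibleCurve γ) (hu : LocallyLipschitz u) (i : Fin m) (s : ℝ≥0) :
    Tendsto (fun t : ℝ => (∫ ω, ((transition B (t - s) - 1) *ᵥ
        fun j => alongCurve u γ j (min (s : ℝ) t) ω) (ω s) ∂condStart P i) / (t - s))
      (𝓝[≠] (s : ℝ)) (𝓝 (∫ ω, ((-B) *ᵥ fun j => alongCurve u γ j s ω) (ω s) ∂condStart P i)) := by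
  have hint : ∀ (r : ℝ) j, Integrable (fun ω => alongCurve u γ j r ω) (condStart P i) :=
    fun r j => hγ.integrable_alongCurve hu j r _
  simp only [integral_mulVec_eval _ s (hint _), Finset.sum_div]
  refine tendsto_finsetSum _ fun k _ => tendsto_finsetSum _ fun j _ => ?_
  have h1 : Tendsto (fun t : ℝ => (transition B (t - s) - 1) k j / (t - s)) (𝓝[≠] (s : ℝ))
      (𝓝 ((-B) k j)) := by
    have h := hasDerivAt_iff_tendsto_slope.1 (hasDerivAt_transition_zero (B := B) k j)
    have hshift : Tendsto (fun t : ℝ => t - s) (𝓝[≠] (s : ℝ)) (𝓝[≠] 0) := by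
      refine tendsto_nhdsWithin_iff.2 ⟨?_, ?_⟩
      · exact ((continuous_sub_right (s : ℝ)).tendsto' _ _ (sub_self _)).mono_left
          nhdsWithin_le_nhds
      · filter_upwards [self_mem_nhdsWithin] with t ht
        exact sub_ne_zero.2 ht
    refine (h.comp hshift).congr fun t => ?_
    simp [slope_def_field, transition]
  have h2 : Tendsto (fun t : ℝ => ∫ ω in {ω | ω s = k}, alongCurve u γ j (min (s : ℝ) t) ω
      ∂condStart P i) (𝓝[≠] (s : ℝ))
      (𝓝 (∫ ω in {ω | ω s = k}, alongCurve u γ j s ω ∂condStart P i)) := by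
    obtain ⟨⟨M, hM⟩, -⟩ := hγ.exists_bound_lipschitz hu s
    refine tendsto_integral_filter_of_dominated_convergence (fun _ => M)
      (Eventually.of_forall fun t => (hint _ j).restrict.aestronglyMeasurable)
      (Eventually.of_forall fun t => Eventually.of_forall fun ω => hM j ω _ (min_le_left _ _))
      (integrable_const _) (Eventually.of_forall fun ω => ?_)
    have hc : Continuous fun t : ℝ => alongCurve u γ j (min (s : ℝ) t) ω :=
      (continuous_alongCurve hu j ω).comp (by fun_prop)
    exact (hc.tendsto' (s : ℝ) _ (by rw [min_self])).mono_left nhdsWithin_le_nhds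
  exact (h1.mul h2).congr fun t => by ring

/-- By right-continuity, the state at time `max s t` is eventually the state at time `s`. -/
lemma CadlagPath.eventually_apply_max_eq (ω : CadlagPath m) (s : ℝ≥0) :
    ∀ᶠ t : ℝ in 𝓝 (s : ℝ), ω (max s t.toNNReal) = ω s := by
  have h1 : ∀ᶠ r in 𝓝[≥] s, ω r = ω s :=
    (ω.right_continuous s).eventually (p := fun k => k = ω s) (by simp)
  have h2 : Tendsto (fun t : ℝ => max s t.toNNReal) (𝓝 (s : ℝ)) (𝓝[≥] s) := by
    refine tendsto_nhdsWithin_iff.2 ⟨?_, Eventually.of_forall fun t =>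
      Set.mem_Ici.2 (le_max_left _ _)⟩
    exact Continuous.tendsto' (by fun_prop) _ _ (by simp)
  exact h2.eventually h1

/-- The transport part converges at every time at which the difference quotients converge
in `L¹`. -/
lemma IsAdmissibleCurve.tendsto_transport_part [IsProbabilityMeasure P]
    (hγ : IsAdmissibleCurve γ) (hu : LocallyLipschitz u) (i : Fin m) (s : ℝ≥0)
    (hD : ∀ j, Integrable (fun ω => deriv (fun t => alongCurve u γ j t ω) s) (condStart P i))
    (hlim : ∀ j, Tendsto (fun t => ∫ ω, |slope (fun r => alongCurve u γ j r ω) s t -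
      deriv (fun r => alongCurve u γ j r ω) s| ∂condStart P i) (𝓝[≠] (s : ℝ)) (𝓝 0)) :
    Tendsto (fun t : ℝ => (∫ ω, (alongCurve u γ (ω (max s t.toNNReal)) t ω -
        alongCurve u γ (ω (max s t.toNNReal)) s ω) ∂condStart P i) / (t - s))
      (𝓝[≠] (s : ℝ))
      (𝓝 (∫ ω, deriv (fun t => alongCurve u γ (ω s) t ω) s ∂condStart P i)) := by
  have hslope : ∀ j t, Integrable (fun ω => slope (fun r => alongCurve u γ j r ω) s t)
      (condStart P i) := fun j t =>
    integrable_slope (fun r => hγ.integrable_alongCurve hu j r _) _ _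
  have hsplit : ∀ t : ℝ, (∫ ω, (alongCurve u γ (ω (max s t.toNNReal)) t ω -
      alongCurve u γ (ω (max s t.toNNReal)) s ω) ∂condStart P i) / (t - s) =
      ∑ j, ∫ ω in {ω | ω (max s t.toNNReal) = j},
        slope (fun r => alongCurve u γ (ω (max s t.toNNReal)) r ω) s t ∂condStart P i := by
    intro t
    rw [← integral_div, ← sum_setIntegral_eval_eq (max s t.toNNReal) (integrable_eval_comp
      (f := fun ω j => slope (fun r => alongCurve u γ j r ω) s t) _ fun j => hslope j t)]
    simp only [slope_def_field]
  simp only [hsplit]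
  rw [sum_setIntegral_eval_eq s (integrable_eval_comp
    (f := fun ω j => deriv (fun t => alongCurve u γ j t ω) s) s hD)]
  refine tendsto_finsetSum _ fun j _ => ?_
  rw [setIntegral_eval_comp s fun ω j => deriv (fun t => alongCurve u γ j t ω) s]
  simp_rw [fun t : ℝ => setIntegral_eval_comp (μ := condStart P i) (max s t.toNNReal)
    (fun ω j => slope (fun r => alongCurve u γ j r ω) s t) j]
  refine tendsto_setIntegral_of_tendsto_integral_abs_sub (fun t => measurableSet_eval_eq _ j)
    (measurableSet_eval_eq s j) (hslope j) (hD j) (hlim j) fun ω => ?_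
  filter_upwards [eventually_nhdsWithin_of_eventually_nhds (ω.eventually_apply_max_eq s)] with t ht
  simp only [ht]

/-- For almost every time, all components of `u` along the curve are differentiable almost surely,
and their difference quotients converge in `L¹`. -/
lemma IsAdmissibleCurve.ae_tendsto_slope [IsProbabilityMeasure P]
    (hγ : IsAdmissibleCurve γ) (hu : LocallyLipschitz u) (i : Fin m) :
    ∀ᵐ r : ℝ, 0 < r → ∀ j,
      (∀ᵐ ω ∂condStart P i, DifferentiableAt ℝ (fun t => alongCurve u γ j t ω) r) ∧
      Integrable (fun ω => deriv (fun t => alongCurve u γ j t ω) r) (condStart P i) ∧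
      Tendsto (fun t => ∫ ω, |slope (fun r => alongCurve u γ j r ω) r t -
        deriv (fun r => alongCurve u γ j r ω) r| ∂condStart P i) (𝓝[≠] r) (𝓝 0) := by
  have h : ∀ᵐ r : ℝ, ∀ n : ℕ, ∀ j, r ∈ Set.Ioo (0 : ℝ) ((n : ℝ≥0) : ℝ) →
      (∀ᵐ ω ∂condStart P i, DifferentiableAt ℝ (fun t => alongCurve u γ j t ω) r) ∧
      Integrable (fun ω => deriv (fun t => alongCurve u γ j t ω) r) (condStart P i) ∧
      Tendsto (fun t => ∫ ω, |slope (fun r => alongCurve u γ j r ω) r t -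
        deriv (fun r => alongCurve u γ j r ω) r| ∂condStart P i) (𝓝[≠] r) (𝓝 0) := by
    refine ae_all_iff.2 fun n => ae_all_iff.2 fun j => ?_
    exact (ae_restrict_iff' measurableSet_Ioo).1
      ((hγ.uniformlyAbsolutelyContinuous_alongCurve hu j n).ae_tendsto_integral_abs_slope_sub_deriv
        (NNReal.coe_nonneg _) (fun t => hγ.integrable_alongCurve hu j t _)
        (hγ.measurableSet_differentiableAt hu j) (hγ.measurable_deriv_alongCurve hu j))
  filter_upwards [h] with r hr hr0 j
  obtain ⟨n, hn⟩ := exists_nat_gt r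
  exact hr n j ⟨hr0, by simpa using hn⟩

end Expectation

end RandomSwitching

theorem mainTheorem2 {m N : ℕ} (B : Matrix (Fin m) (Fin m) ℝ)
    (hB : RandomSwitching.IsCouplingMatrix B)
    (P : Measure (RandomSwitching.CadlagPath m)) [IsProbabilityMeasure P]
    (hP : RandomSwitching.IsMarkovChain B P)
    (u : ℝ≥0 × EuclideanSpace ℝ (Fin N) → (Fin m → ℝ)) (hu : LocallyLipschitz u)
    (γ : RandomSwitching.CadlagPath m → C(ℝ≥0, EuclideanSpace ℝ (Fin N)))
    (hγ : RandomSwitching.IsAdmissibleCurve γ) (i : Fin m) :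
    (∀ t : ℝ≥0, Integrable (fun ω => u (t, γ ω t) (ω t)) (RandomSwitching.condStart P i)) ∧
    ∀ᵐ r : ℝ, ∀ s : ℝ≥0, (s : ℝ) = r →
      (∀ᵐ ω ∂(RandomSwitching.condStart P i),
        DifferentiableAt ℝ (fun t : ℝ => u (t.toNNReal, γ ω t.toNNReal) (ω s)) s) ∧
      Integrable
        (fun ω => -(B *ᵥ u (s, γ ω s)) (ω s) +
          deriv (fun t : ℝ => u (t.toNNReal, γ ω t.toNNReal) (ω s)) s)
        (RandomSwitching.condStart P i) ∧
      HasDerivAt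
        (fun t : ℝ => ∫ ω, u (t.toNNReal, γ ω t.toNNReal) (ω t.toNNReal)
          ∂(RandomSwitching.condStart P i))
        (∫ ω, (-(B *ᵥ u (s, γ ω s)) (ω s) +
            deriv (fun t : ℝ => u (t.toNNReal, γ ω t.toNNReal) (ω s)) s)
          ∂(RandomSwitching.condStart P i))
        s := by
  open RandomSwitching in
  have hint : ∀ (r : ℝ) j, Integrable (fun ω => alongCurve u γ j r ω) (condStart P i) :=
    fun r j => hγ.integrable_alongCurve hu j r _
  have halong : ∀ (r : ℝ≥0) ω, u (r, γ ω r) = fun j => alongCurve u γ j r ω := by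
    intro r ω; ext j; simp [alongCurve]
  refine ⟨fun t => ?_, ?_⟩
  · simp only [halong]
    exact integrable_eval_comp (f := fun ω j => alongCurve u γ j t ω) t (hint t)
  -- At `0` the function of a real time is extended by constants, so a two-sided derivative need
  -- not exist there.
  have hne0 : ∀ᵐ r : ℝ, r ≠ 0 := by simp [ae_iff, measure_singleton]
  filter_upwards [hγ.ae_tendsto_slope (P := P) hu i, hne0] with r hr hr0 s hs
  subst hs
  have hs0 : (0 : ℝ) < s := lt_of_le_of_ne s.coe_nonneg (Ne.symm hr0)
  have hslope := hr hs0
  have hswitch : Integrable (fun ω => -(B *ᵥ u (s, γ ω s)) (ω s)) (condStart P i) := by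
    simp only [halong]
    exact (integrable_mulVec_eval B s (hint s)).neg
  have htrans : Integrable (fun ω => deriv (fun t : ℝ =>
      u (t.toNNReal, γ ω t.toNNReal) (ω s)) s) (condStart P i) :=
    integrable_eval_comp (f := fun ω j => deriv (fun t => alongCurve u γ j t ω) s) s
      fun j => (hslope j).2.1
  refine ⟨?_, hswitch.add htrans, ?_⟩
  · filter_upwards [ae_all_iff.2 fun j => (hslope j).1] with ω hω
    exact hω (ω s)
  rw [hasDerivAt_iff_tendsto_slope, integral_add hswitch htrans]
  have h := (hγ.tendsto_switching_part (B := B) (P := P) hu i s).add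
    (hγ.tendsto_transport_part hu i s (fun j => (hslope j).2.1) fun j => (hslope j).2.2)
  have hB' : ∫ ω, -(B *ᵥ u (s, γ ω s)) (ω s) ∂condStart P i =
      ∫ ω, ((-B) *ᵥ fun j => alongCurve u γ j s ω) (ω s) ∂condStart P i := by
    simp only [halong, neg_mulVec, Pi.neg_apply]
  rw [hB']
  refine h.congr' ?_
  filter_upwards [self_mem_nhdsWithin,
    eventually_nhdsWithin_of_eventually_nhds (Ioi_mem_nhds hs0)] with t hts ht0
  lift t to ℝ≥0 using le_of_lt ht0
  have hts' : t ≠ s := fun h => hts (by simp [h])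
  have hinc := hγ.integral_increment hP hu i hts'
  simp only [slope_def_field, Real.toNNReal_coe, halong]
  rw [hinc, add_div, NNReal.coe_min]
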